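/- Let $R$ be an associative ring with identity; all modules are unitary left $R$-modules, and $M$ is a fixed module. For modules $M,X$ and a class $\mathcal C$ of modules put $\mathrm{Ann}_M(\mathcal C)=\bigcap\{\ker f : W\in\mathcal C,\ f\in\mathrm{Hom}_R(M,W)\}$ and $\mathrm{Ann}_M(X)=\mathrm{Ann}_M(\{X\})$. For a submodule $N\le M$ and a module $X$ put $N\cdot X=\mathrm{Ann}_X(\mathcal C_N)$, where $\mathcal C_N$ is the class of modules $W$ with $f(N)=0$ for all $f\in\mathrm{Hom}_R(M,W)$. Let $\sigma[M]$ be the class of modules isomorphic to a submodule of an epimorphic image of a direct sum of copies of $M$. A module $X$ is *$M$-prime* if $X\ne 0$ and, for all submodules $N\le M$ and $Y\le X$, $N\cdot Y=0$ implies $N\cdot X=0$ or $Y=0$. An *$M$-ideal* is a submodule of $M$ of the form $\mathrm{Ann}_M(\mathcal C)$ with $\mathcal C$ a class of modules in $\sigma[M]$. A *prime $M$-ideal* is a proper $M$-ideal $P\subsetneq M$ with $P=\mathrm{Ann}_M(X)$ for some $M$-prime module $X$. A module $X$ is *$M$-injective* if every homomorphism from a submodule of $M$ to $X$ extends to $M$.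 The module $M$ *satisfies condition $H$* if for every $X\in\sigma[M]$ that is an epimorphic image of $M^n$ for some positive integer $n$ there are a positive integer $m$ and a monomorphism $M/\mathrm{Ann}_M(X)\to X^m$. **Corollary 4.2.** Let $M$ be a Noetherian module that satisfies condition $H$, and suppose that $\mathrm{Hom}_R(M,X)\ne 0$ for every nonzero $X\in\sigma[M]$. Then there is a one-to-one correspondence between isomorphism classes of indecomposable $M$-injective modules in $\sigma[M]$ and prime $M$-ideals of $M$. More precisely, every indecomposable $M$-injective module $E$ in $\sigma[M]$ has an $M$-prime submodule (i.e. a submodule that is itself an $M$-prime module), all $M$-prime submodules $Y$ of $E$ in this sense have the same annihilator $\mathrm{Ann}_M(Y)$, and sending the isomorphism class of $E$ to this annihilator is a bijection onto the set of prime $M$-ideals. -/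

import Mathlib

universe u v w

namespace MIdeal

open CategoryTheory

variable {R : Type u} [Ring R]

/-- `Ann_M(C)`: the intersection of the kernels of all homomorphisms from `M` into modules
of the class `C`. -/
def Ann (M : Type w) [AddCommGroup M] [Module R M] (C : Set (ModuleCat.{w} R)) :
    Submodule R M :=
  sInf {K | ∃ W ∈ C, ∃ f : M →ₗ[R] W, K = LinearMap.ker f}

/-- `Ann_M(X)` for a single module `X`: the intersection of the kernels of all
homomorphisms `M → X`. -/
def annModule (M : Type w) [AddCommGroup M] [Module R M]
    (X : Type w) [AddCommGroup X] [Module R X] : Submodule R M :=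
  Ann M {ModuleCat.of R X}

/-- `N · X = Ann_X(C)`, where `C` is the class of modules `W` such that `f(N) = 0` for all
`f ∈ Hom_R(M, W)`. -/
def prod {M : Type w} [AddCommGroup M] [Module R M] (N : Submodule R M)
    (X : Type w) [AddCommGroup X] [Module R X] : Submodule R X :=
  Ann X {W : ModuleCat.{w} R | ∀ f : M →ₗ[R] W, ∀ n ∈ N, f n = 0}

/-- `Y` is `M`-generated: an epimorphic image of a direct sum of copies of `M`. -/
def IsGenerated (M : Type w) [AddCommGroup M] [Module R M]
    (Y : Type w) [AddCommGroup Y] [Module R Y] : Prop :=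
  ∃ (ι : Type w) (f : (ι →₀ M) →ₗ[R] Y), Function.Surjective f

/-- `X` belongs to `σ[M]`: it is isomorphic to a submodule of an `M`-generated module. -/
def InSigma (M : Type w) [AddCommGroup M] [Module R M]
    (X : Type w) [AddCommGroup X] [Module R X] : Prop :=
  ∃ Y : ModuleCat.{w} R, IsGenerated (R := R) M Y ∧
    ∃ S : Submodule R Y, Nonempty (X ≃ₗ[R] S)

/-- `P` is an `M`-ideal: `P = Ann_M(C)` for a class `C` of modules in `σ[M]`. -/
def IsMIdeal {M : Type w} [AddCommGroup M] [Module R M] (P : Submodule R M) : Prop :=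
  ∃ C : Set (ModuleCat.{w} R), (∀ W ∈ C, InSigma (R := R) M W) ∧ P = Ann M C

/-- `P` is an `M`-prime submodule of `X`. For `Y ≤ X`, the submodule `N · Y` of `Y` is
regarded as a submodule of `X`. -/
def IsMPrimeSubmodule (M : Type w) [AddCommGroup M] [Module R M]
    {X : Type w} [AddCommGroup X] [Module R X] (P : Submodule R X) : Prop :=
  P ≠ ⊤ ∧ ∀ (N : Submodule R M) (Y : Submodule R X),
    (prod N Y).map Y.subtype ≤ P → prod N X ≤ P ∨ Y ≤ P

/-- `X` is an `M`-prime module: `0` is a (proper) `M`-prime submodule of `X`. -/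
def IsMPrimeModule (R : Type u) [Ring R] (M : Type w) [AddCommGroup M] [Module R M]
    (X : Type w) [AddCommGroup X] [Module R X] : Prop :=
  IsMPrimeSubmodule M (⊥ : Submodule R X)

/-- `P` is a prime `M`-ideal: a proper `M`-ideal of the form `Ann_M(X)` for some `M`-prime
module `X`. -/
def IsPrimeMIdeal {M : Type w} [AddCommGroup M] [Module R M] (P : Submodule R M) : Prop :=
  P ≠ ⊤ ∧ IsMIdeal P ∧ ∃ X : ModuleCat.{w} R, IsMPrimeModule R M X ∧ P = annModule M X

/-- `X` is `M`-injective: every homomorphism from a submodule of `M` to `X` extends to `M`. -/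
def IsMInjective (R : Type u) [Ring R] (M : Type w) [AddCommGroup M] [Module R M]
    (X : Type w) [AddCommGroup X] [Module R X] : Prop :=
  ∀ (K : Submodule R M) (f : K →ₗ[R] X), ∃ g : M →ₗ[R] X, ∀ k : K, g k = f k

/-- `X` is finitely `M`-generated: there is an epimorphism `Mⁿ → X` with `n` positive. -/
def IsFinitelyGenerated (R : Type u) [Ring R] (M : Type w) [AddCommGroup M] [Module R M]
    (X : Type w) [AddCommGroup X] [Module R X] : Prop :=
  ∃ n : ℕ, 0 < n ∧ ∃ f : (Fin n → M) →ₗ[R] X, Function.Surjective f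

/-- `X` is finitely `M`-annihilated: there is a monomorphism `M / Ann_M(X) → Xᵐ` with `m`
positive. -/
def IsFinitelyAnnihilated (R : Type u) [Ring R] (M : Type w) [AddCommGroup M] [Module R M]
    (X : Type w) [AddCommGroup X] [Module R X] : Prop :=
  ∃ m : ℕ, 0 < m ∧ ∃ g : (M ⧸ annModule (R := R) M X) →ₗ[R] (Fin m → X), Function.Injective g

/-- Condition `H`: every module in `σ[M]` that is finitely `M`-generated is finitely
`M`-annihilated. -/
def ConditionH (R : Type u) [Ring R] (M : Type w) [AddCommGroup M] [Module R M] : Prop :=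
  ∀ X : ModuleCat.{w} R, InSigma (R := R) M X → IsFinitelyGenerated R M X →
    IsFinitelyAnnihilated R M X

/-- The indecomposable `M`-injective modules in `σ[M]`. -/
def IndecInj (R : Type u) [Ring R] (M : Type w) [AddCommGroup M] [Module R M] : Type _ :=
  {E : ModuleCat.{w} R // InSigma (R := R) M E ∧ IsMInjective R M E ∧ Indecomposable E}

/-- Isomorphism of `R`-modules, as an equivalence relation on `IndecInj R M`. -/
def IndecInj.isoSetoid (R : Type u) [Ring R] (M : Type w) [AddCommGroup M] [Module R M] :
    Setoid (IndecInj R M) where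
  r E E' := Nonempty (E.1 ≃ₗ[R] E'.1)
  iseqv :=
    { refl := fun _ => ⟨LinearEquiv.refl R _⟩
      symm := fun ⟨e⟩ => ⟨e.symm⟩
      trans := fun ⟨e⟩ ⟨e'⟩ => ⟨e.trans e'⟩ }

/-- Isomorphism classes of indecomposable `M`-injective modules in `σ[M]`. -/
def IndecInjClass (R : Type u) [Ring R] (M : Type w) [AddCommGroup M] [Module R M] : Type _ :=
  Quotient (IndecInj.isoSetoid R M)

/-- The isomorphism class of an indecomposable `M`-injective module in `σ[M]`. -/
def IndecInj.isoClass {M : Type w} [AddCommGroup M] [Module R M] (E : IndecInj R M) :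
    IndecInjClass R M :=
  Quotient.mk (IndecInj.isoSetoid R M) E

end MIdeal

/-!
The product `N · X` vanishes exactly when `N ≤ Ann_M(X)`, so a nonzero module is `M`-prime exactly
when all its nonzero submodules have the same annihilator in `M` (`isMPrimeModule_iff`). Hence, for
Noetherian `M`, every nonzero module has an `M`-prime submodule: one whose annihilator is maximal
(`exists_submodule_isMPrimeModule`).

An `M`-injective module is injective with respect to all monomorphisms into modules of `σ[M]`, by
Baer's argument (`IsMInjective.exists_extension`). Therefore complements in an `M`-injective module
of `σ[M]` are direct summands, and the indecomposable ones are uniform (`IsMInjective.isUniform`).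
Two prime submodules of such a module `E` meet in a nonzero module, so they have the same
annihilator `P`; it is proper because `Hom(M, Y) ≠ 0` for every nonzero `Y` in `σ[M]`.

The map `E ↦ P` is injective by condition `H`: the nonzero module `M / P` embeds in a power of `E`,
so some nonzero submodule of it embeds in `E`. If `E'` has the same `P`, then `E` and `E'` have a
common nonzero submodule, and both are its injective hull in `σ[M]`
(`IndecInj.nonempty_linearEquiv`). It is surjective because a prime `M`-ideal `P = Ann_M(X)` is also
the annihilator of a Noetherian image of `M` in `X`, hence of a uniform submodule `V` of that image.
The hull of `V` in `σ[M]` is built as a direct summand of the trace of `M` in an injective module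
(`IsPrimeMIdeal.exists_indecInj`).
-/

namespace MIdeal

open CategoryTheory

/-! ### Annihilators and prime modules -/

section Annihilators

variable {R : Type u} [Ring R] {M : Type w} [AddCommGroup M] [Module R M]
  {X : Type w} [AddCommGroup X] [Module R X] {Y : Type w} [AddCommGroup Y] [Module R Y]

theorem map_eq_bot_iff_of_injective (f : Y →ₗ[R] X) (hf : Function.Injective f)
    {Z : Submodule R Y} : Z.map f = ⊥ ↔ Z = ⊥ :=
  (Submodule.map_injective_of_injective hf).eq_iff' (Submodule.map_bot f)

theorem mem_annModule {m : M} : m ∈ annModule (R := R) M X ↔ ∀ f : M →ₗ[R] X, f m = 0 := by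
  simp only [annModule, Ann, Submodule.mem_sInf, Set.mem_ofPred_eq, Set.mem_singleton_iff]
  refine ⟨fun h f => h _ ⟨_, rfl, f, rfl⟩, ?_⟩
  rintro h _ ⟨_, rfl, f, rfl⟩
  exact h f

theorem annModule_le_of_injective (i : Y →ₗ[R] X) (hi : Function.Injective i) :
    annModule (R := R) M X ≤ annModule M Y := by
  intro m hm
  rw [mem_annModule] at hm ⊢
  exact fun f => hi (by simpa using hm (i ∘ₗ f))

theorem annModule_congr (e : X ≃ₗ[R] Y) : annModule (R := R) M X = annModule M Y :=
  le_antisymm (annModule_le_of_injective e.symm.toLinearMap e.symm.injective)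
    (annModule_le_of_injective e.toLinearMap e.injective)

theorem annModule_ne_top_iff : annModule (R := R) M X ≠ ⊤ ↔ ∃ f : M →ₗ[R] X, f ≠ 0 := by
  rw [Ne, Submodule.eq_top_iff']
  simp only [mem_annModule, not_forall]
  exact ⟨fun ⟨m, f, h⟩ => ⟨f, fun hf => h (by simp [hf])⟩, fun ⟨f, hf⟩ => by
    obtain ⟨m, hm⟩ := DFunLike.ne_iff.1 hf
    exact ⟨m, f, hm⟩⟩

/-- The product `N · X` vanishes exactly when `N` annihilates `X`: in one direction `X` itself
belongs to the class of modules annihilated by `N`, in the other direction that class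
separates the points of `X`. -/
theorem prod_eq_bot_iff {N : Submodule R M} :
    prod N X = ⊥ ↔ N ≤ annModule (R := R) M X := by
  constructor
  · intro h n hn
    refine mem_annModule.2 fun f => ?_
    rw [← Submodule.mem_bot R, ← h]
    simp only [prod, Ann, Submodule.mem_sInf, Set.mem_ofPred_eq]
    rintro _ ⟨W, hW, g, rfl⟩
    exact hW (g ∘ₗ f) n hn
  · intro h
    rw [eq_bot_iff]
    refine sInf_le ⟨ModuleCat.of R X, fun f n hn => mem_annModule.1 (h hn) f,
      LinearMap.id, LinearMap.ker_id.symm⟩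

theorem isMPrimeModule_iff : IsMPrimeModule R M X ↔ Nontrivial X ∧
    ∀ Y : Submodule R X, Y ≠ ⊥ → annModule (R := R) M Y ≤ annModule M X := by
  have hmap (N : Submodule R M) (Y : Submodule R X) :
      (prod N Y).map Y.subtype ≤ ⊥ ↔ N ≤ annModule (R := R) M Y := by
    rw [le_bot_iff, map_eq_bot_iff_of_injective _ Y.subtype_injective, prod_eq_bot_iff]
  unfold IsMPrimeModule IsMPrimeSubmodule
  simp only [hmap, le_bot_iff, prod_eq_bot_iff, ne_comm (a := (⊥ : Submodule R X)),
    ← Submodule.nontrivial_iff R (M := X)]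
  refine and_congr ⟨fun h => ⟨⟨_, _, h⟩⟩, fun _ => top_ne_bot⟩
    ⟨fun h Y hY => ?_, fun h N Y hN => ?_⟩
  · exact (h _ Y le_rfl).resolve_right hY
  · exact or_iff_not_imp_right.2 fun hY => hN.trans (h Y hY)

theorem IsMPrimeModule.annModule_eq (hX : IsMPrimeModule R M X) [Nontrivial Y]
    (i : Y →ₗ[R] X) (hi : Function.Injective i) : annModule (R := R) M Y = annModule M X := by
  refine le_antisymm ?_ (annModule_le_of_injective i hi)
  rw [annModule_congr (LinearEquiv.ofInjective i hi)]
  refine (isMPrimeModule_iff.1 hX).2 _ fun h => ?_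
  rw [LinearMap.range_eq_bot] at h
  obtain ⟨y, hy⟩ := exists_ne (0 : Y)
  exact hy (hi (by simp [h]))

theorem IsMPrimeModule.of_injective (hX : IsMPrimeModule R M X) [Nontrivial Y]
    (i : Y →ₗ[R] X) (hi : Function.Injective i) : IsMPrimeModule R M Y := by
  refine isMPrimeModule_iff.2 ⟨‹_›, fun Z hZ => ?_⟩
  have : Nontrivial Z := Submodule.nontrivial_iff_ne_bot.2 hZ
  rw [hX.annModule_eq i hi, hX.annModule_eq (i ∘ₗ Z.subtype) (hi.comp Z.subtype_injective)]

/-- A nonzero submodule with maximal annihilator is prime. -/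
theorem exists_submodule_isMPrimeModule [IsNoetherian R M] [Nontrivial X] :
    ∃ Y : Submodule R X, IsMPrimeModule R M Y := by
  obtain ⟨P, ⟨Y, hY, rfl⟩, hmax⟩ := wellFounded_gt.has_min
    {P : Submodule R M | ∃ Y : Submodule R X, Y ≠ ⊥ ∧ P = annModule M Y} ⟨_, ⊤, top_ne_bot, rfl⟩
  refine ⟨Y, isMPrimeModule_iff.2 ⟨Submodule.nontrivial_iff_ne_bot.2 hY, fun Z hZ => ?_⟩⟩
  have hZ' : annModule (R := R) M Z = annModule M (Z.map Y.subtype) :=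
    annModule_congr (Submodule.equivMapOfInjective _ Y.subtype_injective Z)
  have h := hmax _ ⟨Z.map Y.subtype, by
    rwa [Ne, map_eq_bot_iff_of_injective _ Y.subtype_injective], rfl⟩
  rw [← hZ'] at h
  exact ((annModule_le_of_injective Z.subtype Z.subtype_injective).eq_of_not_lt h).ge

theorem InSigma.of_injective (hX : InSigma (R := R) M X) (i : Y →ₗ[R] X)
    (hi : Function.Injective i) : InSigma (R := R) M Y := by
  obtain ⟨W, hW, S, ⟨e⟩⟩ := hX
  have hj : Function.Injective (S.subtype ∘ₗ e.toLinearMap ∘ₗ i) :=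
    S.subtype_injective.comp (e.injective.comp hi)
  exact ⟨W, hW, _, ⟨LinearEquiv.ofInjective _ hj⟩⟩

theorem IsGenerated.inSigma (hX : IsGenerated (R := R) M X) : InSigma (R := R) M X :=
  ⟨ModuleCat.of R X, hX, ⊤, ⟨(Submodule.topEquiv (R := R) (M := X)).symm⟩⟩

end Annihilators

/-! ### Relative injectivity -/

section Injectivity

variable {R : Type u} [Ring R] {M : Type w} [AddCommGroup M] [Module R M]
  {E : Type w} [AddCommGroup E] [Module R E]
  {X : Type w} [AddCommGroup X] [Module R X] {Y : Type w} [AddCommGroup Y] [Module R Y]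

/-- The one-step extension in Baer's argument, with the cyclic submodule generated by a new
element replaced by the image of a map `φ : M → Y`. -/
theorem IsMInjective.exists_extension_range (hE : IsMInjective R M E) (p : Y →ₗ.[R] E)
    (φ : M →ₗ[R] Y) : ∃ q : Y →ₗ.[R] E, p ≤ q ∧ LinearMap.range φ ≤ q.domain := by
  obtain ⟨g, hg⟩ := hE (p.domain.comap φ)
    (p.toFun ∘ₗ (φ.restrict (p := p.domain.comap φ) (q := p.domain) fun _ h => h))
  have hg' (m : M) (hm : φ m ∈ p.domain) : g m = p ⟨φ m, hm⟩ := hg ⟨m, hm⟩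
  have hker : LinearMap.ker φ ≤ LinearMap.ker g := by
    intro m hm
    have hm : φ m = 0 := hm
    have h0 : φ m ∈ p.domain := hm ▸ p.domain.zero_mem
    rw [LinearMap.mem_ker, hg' m h0, ← p.map_zero]
    exact congrArg p (Subtype.ext hm)
  let r : Y →ₗ.[R] E := ⟨LinearMap.range φ,
    (LinearMap.ker φ).liftQ g hker ∘ₗ φ.quotKerEquivRange.symm.toLinearMap⟩
  have hr (m : M) : r ⟨φ m, m, rfl⟩ = g m := by
    change (LinearMap.ker φ).liftQ g hker (φ.quotKerEquivRange.symm ⟨φ m, m, rfl⟩) = g m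
    have : φ.quotKerEquivRange.symm ⟨φ m, m, rfl⟩ = (LinearMap.ker φ).mkQ m := by
      rw [LinearEquiv.symm_apply_eq]; rfl
    rw [this]
    exact Submodule.liftQ_apply _ _ _
  have hcompat : ∀ (x : p.domain) (y : r.domain), (x : Y) = y → p x = r y := by
    rintro ⟨_, hx⟩ ⟨_, m, rfl⟩ rfl
    rw [hr, hg' m hx]
  exact ⟨p.sup r hcompat, p.left_le_sup r hcompat, (p.right_le_sup r hcompat).1⟩

theorem IsMInjective.exists_extension_of_isGenerated (hE : IsMInjective R M E)
    (hY : IsGenerated (R := R) M Y) (p : Y →ₗ.[R] E) :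
    ∃ g : Y →ₗ[R] E, ∀ y : p.domain, g y = p y := by
  obtain ⟨q, hpq, hq⟩ := zorn_le_nonempty_Ici₀ p (fun c _ hc y hy =>
    ⟨LinearPMap.sSup c hc.directedOn, fun z hz => LinearPMap.le_sSup _ hz⟩) p le_rfl
  have hdom : q.domain = ⊤ := by
    obtain ⟨ι, f, hf⟩ := hY
    rw [eq_top_iff, ← LinearMap.range_eq_top.2 hf, LinearMap.range_eq_map,
      ← Finsupp.iSup_lsingle_range, Submodule.map_iSup, iSup_le_iff]
    intro i
    rw [← LinearMap.range_comp]
    obtain ⟨q', hqq', hq'⟩ := hE.exists_extension_range q (f ∘ₗ Finsupp.lsingle i)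
    exact hq'.trans (hq hqq').1
  refine ⟨q.toFun ∘ₗ (LinearEquiv.ofTop _ hdom).symm.toLinearMap, fun y => ?_⟩
  exact (hpq.2 (y := ⟨y, hpq.1 y.2⟩) rfl).symm

/-- Baer's criterion relative to `M`: an `M`-injective module is injective with respect to all
monomorphisms into modules of `σ[M]`. -/
theorem IsMInjective.exists_extension (hE : IsMInjective R M E) (hX : InSigma (R := R) M X)
    (i : Y →ₗ[R] X) (hi : Function.Injective i) (f : Y →ₗ[R] E) :
    ∃ g : X →ₗ[R] E, ∀ y, g (i y) = f y := by
  obtain ⟨W, hW, S, ⟨e⟩⟩ := hX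
  let j : X →ₗ[R] W := S.subtype ∘ₗ e.toLinearMap
  have hj : Function.Injective (j ∘ₗ i) := (S.subtype_injective.comp e.injective).comp hi
  obtain ⟨g, hg⟩ := hE.exists_extension_of_isGenerated hW
    ⟨_, f ∘ₗ (LinearEquiv.ofInjective _ hj).symm.toLinearMap⟩
  refine ⟨g ∘ₗ j, fun y => (hg ⟨j (i y), y, rfl⟩).trans ?_⟩
  change f ((LinearEquiv.ofInjective _ hj).symm ⟨(j ∘ₗ i) y, _⟩) = f y
  congr 1
  rw [LinearEquiv.symm_apply_eq]
  rfl

/-- A retract of an `M`-injective module is `M`-injective. -/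
theorem IsMInjective.of_retract (hE : IsMInjective R M E) (i : X →ₗ[R] E) (r : E →ₗ[R] X)
    (hr : ∀ x, r (i x) = x) : IsMInjective R M X := fun K f => by
  obtain ⟨g, hg⟩ := hE K (i ∘ₗ f)
  exact ⟨r ∘ₗ g, fun k => by simp [hg, hr]⟩

end Injectivity

/-! ### Uniform modules and complements -/

section Uniform

/-- A module is uniform if it is nonzero and two nonzero submodules never intersect in zero. -/
def IsUniform (R : Type u) [Ring R] (X : Type w) [AddCommGroup X] [Module R X] : Prop :=
  Nontrivial X ∧ ∀ A B : Submodule R X, Disjoint A B → A = ⊥ ∨ B = ⊥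

variable {R : Type u} [Ring R] {M : Type w} [AddCommGroup M] [Module R M]
  {E : Type w} [AddCommGroup E] [Module R E]
  {X : Type w} [AddCommGroup X] [Module R X] {Y : Type w} [AddCommGroup Y] [Module R Y]

/-- An essential extension of a uniform module is uniform. -/
theorem IsUniform.of_essential (hY : IsUniform R Y) (i : Y →ₗ[R] X) (hi : Function.Injective i)
    (hess : ∀ Z : Submodule R X, Disjoint Z (LinearMap.range i) → Z = ⊥) : IsUniform R X := by
  have := hY.1
  refine ⟨hi.nontrivial, fun A B hAB => ?_⟩
  have key (Z : Submodule R X) (hZ : Z.comap i = ⊥) : Z = ⊥ := by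
    refine hess Z (Submodule.disjoint_def.2 ?_)
    rintro _ hx ⟨y, rfl⟩
    have : y ∈ Z.comap i := hx
    rw [hZ, Submodule.mem_bot] at this
    simp [this]
  refine (hY.2 (A.comap i) (B.comap i) ?_).imp (key A) (key B)
  refine Submodule.disjoint_def.2 fun y hA hB => hi ?_
  rw [map_zero]
  exact Submodule.disjoint_def.1 hAB _ hA hB

/-- A nonzero Noetherian module has a uniform submodule: if `B` is maximal among the submodules
that are disjoint from some nonzero submodule `A`, then `A` is uniform. -/
theorem exists_submodule_isUniform [IsNoetherian R X] [Nontrivial X] :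
    ∃ V : Submodule R X, IsUniform R V := by
  obtain ⟨B, ⟨A, hA, hAB⟩, hmax⟩ := wellFounded_gt.has_min
    {B : Submodule R X | ∃ A : Submodule R X, A ≠ ⊥ ∧ Disjoint A B}
    ⟨⊥, ⊤, top_ne_bot, disjoint_bot_right⟩
  refine ⟨A, Submodule.nontrivial_iff_ne_bot.2 hA, fun A₁ A₂ h =>
    or_iff_not_imp_right.2 fun h₂ => ?_⟩
  have hinj := A.subtype_injective
  have h' : Disjoint (A₁.map A.subtype) (A₂.map A.subtype) := (Submodule.disjoint_map hinj h)
  have h₁A := Submodule.map_subtype_le A A₁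
  have hsup : A₁.map A.subtype ⊔ A₂.map A.subtype ≤ A :=
    sup_le h₁A (Submodule.map_subtype_le A A₂)
  have hdisj : Disjoint (A₂.map A.subtype) (A₁.map A.subtype ⊔ B) :=
    h'.symm.disjoint_sup_right_of_disjoint_sup_left ((sup_comm _ _).le.trans hsup |> hAB.mono_left)
  have hle : A₁.map A.subtype ≤ B := by
    by_contra hcon
    refine hmax (A₁.map A.subtype ⊔ B) ⟨_, ?_, hdisj⟩ (right_lt_sup.2 hcon)
    rwa [Ne, map_eq_bot_iff_of_injective _ hinj]
  rw [← map_eq_bot_iff_of_injective _ hinj]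
  exact disjoint_self.1 (hAB.mono h₁A hle)

theorem exists_maximal_disjoint (A B : Submodule R X) (hAB : Disjoint A B) :
    ∃ C, A ≤ C ∧ Maximal (Disjoint · B) C := by
  refine zorn_le_nonempty₀ {C : Submodule R X | Disjoint C B} (fun c hc hch y hy => ?_) A hAB
  refine ⟨sSup c, ?_, fun z hz => le_sSup hz⟩
  exact hch.directedOn.disjoint_sSup_left.2 hc

/-- The projection of `A ⊕ B` onto `A` extends to an endomorphism `h` of `E`; maximality of `B`
gives `h ⁻¹ B = B`, and then maximality of `A` shows that `h` maps `E` onto `A`. -/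
theorem exists_projection_of_maximal_disjoint (hE : IsMInjective R M E)
    (hσ : InSigma (R := R) M E) {A B : Submodule R E} (hA : Maximal (Disjoint · B) A)
    (hB : Maximal (Disjoint · A) B) :
    ∃ r : E →ₗ[R] A, (∀ a : A, r a = a) ∧ LinearMap.ker r = B := by
  have hAB : Disjoint A B := hA.prop
  let s : (A × B) →ₗ[R] E := A.subtype.coprod B.subtype
  have hs : Function.Injective s := by
    rw [← LinearMap.ker_eq_bot, LinearMap.ker_coprod_of_disjoint_range]
    · simp
    · simpa using hAB
  obtain ⟨h, hh⟩ := hE.exists_extension hσ s hs (A.subtype ∘ₗ LinearMap.fst R A B)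
  have hhA (a : E) (ha : a ∈ A) : h a = a := by simpa [s] using hh (⟨a, ha⟩, 0)
  have hhB (b : E) (hb : b ∈ B) : h b = 0 := by simpa [s] using hh (0, ⟨b, hb⟩)
  have hcomap : B.comap h ≤ B := by
    refine hB.2 (Submodule.disjoint_def.2 fun a haB haA => ?_) fun b hb => ?_
    · rw [Submodule.mem_comap, hhA a haA] at haB
      exact Submodule.disjoint_def.1 hAB a haA haB
    · simp [hhB b hb]
  have hrange : LinearMap.range h ≤ A := by
    refine hA.2 (Submodule.disjoint_def.2 ?_) fun a ha => ⟨a, hhA a ha⟩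
    rintro _ ⟨e, rfl⟩ he
    exact hhB e (hcomap he)
  refine ⟨h.codRestrict A fun e => hrange ⟨e, rfl⟩, fun a => Subtype.ext (hhA a a.2), ?_⟩
  rw [LinearMap.ker_codRestrict]
  refine le_antisymm (fun e he => hcomap ?_) hhB
  rw [Submodule.mem_comap, LinearMap.mem_ker.1 he]
  exact B.zero_mem

theorem IsUniform.eq_bot_or_eq_bot_of_prod {E₁ E₂ : Type*} [AddCommGroup E₁] [Module R E₁]
    [AddCommGroup E₂] [Module R E₂] (hX : IsUniform R X) (e : X ≃ₗ[R] E₁ × E₂) :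
    Subsingleton E₁ ∨ Subsingleton E₂ := by
  have hdisj : Disjoint (LinearMap.ker (LinearMap.fst R E₁ E₂ ∘ₗ e.toLinearMap))
      (LinearMap.ker (LinearMap.snd R E₁ E₂ ∘ₗ e.toLinearMap)) := by
    refine Submodule.disjoint_def.2 fun x h₁ h₂ => e.injective ?_
    rw [map_zero]
    exact Prod.ext h₁ h₂
  refine (hX.2 _ _ hdisj).symm.imp (fun h => ⟨fun a b => ?_⟩) (fun h => ⟨fun a b => ?_⟩)
  · have : e.symm (a - b, 0) ∈ LinearMap.ker (LinearMap.snd R E₁ E₂ ∘ₗ e.toLinearMap) := by simp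
    rw [h, Submodule.mem_bot, LinearEquiv.map_eq_zero_iff] at this
    exact sub_eq_zero.1 (congrArg Prod.fst this)
  · have : e.symm (0, a - b) ∈ LinearMap.ker (LinearMap.fst R E₁ E₂ ∘ₗ e.toLinearMap) := by simp
    rw [h, Submodule.mem_bot, LinearEquiv.map_eq_zero_iff] at this
    exact sub_eq_zero.1 (congrArg Prod.snd this)

theorem IsUniform.indecomposable {X : ModuleCat.{w} R} (hX : IsUniform R X) :
    Indecomposable X := by
  have := hX.1
  refine ⟨fun h => not_subsingleton X (ModuleCat.subsingleton_of_isZero h), fun Y Z e => ?_⟩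
  exact (hX.eq_bot_or_eq_bot_of_prod (e ≪≫ ModuleCat.biprodIsoProd Y Z).toLinearEquiv).imp
    (fun h => @ModuleCat.isZero_of_subsingleton _ _ Y h)
    (fun h => @ModuleCat.isZero_of_subsingleton _ _ Z h)

theorem IsMInjective.isUniform {E : ModuleCat.{w} R} (hE : IsMInjective R M E)
    (hσ : InSigma (R := R) M E) (hind : Indecomposable E) : IsUniform R E := by
  refine ⟨not_subsingleton_iff_nontrivial.1 fun _ =>
    hind.1 (ModuleCat.isZero_of_subsingleton E), fun A₀ B₀ h => ?_⟩
  -- Enlarging `A₀` and then `B₀` gives submodules each of which is maximal disjoint from the other.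
  obtain ⟨A, hA₀, hA⟩ := exists_maximal_disjoint A₀ B₀ h
  obtain ⟨B, hB₀, hB⟩ := exists_maximal_disjoint B₀ A hA.prop.symm
  have hA' : Maximal (Disjoint · B) A :=
    ⟨hB.prop.symm, fun C hC hAC => hA.2 (hC.mono_right hB₀) hAC⟩
  obtain ⟨r, hr, hker⟩ := exists_projection_of_maximal_disjoint hE hσ hA' hB
  have hcompl : IsCompl A B := hker ▸ LinearMap.isCompl_of_proj hr
  have key (C : Submodule R E) (hC : Limits.IsZero (ModuleCat.of R C)) : C = ⊥ :=
    (Submodule.subsingleton_iff_eq_bot).1 (ModuleCat.subsingleton_of_isZero hC)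
  have e : E ≃ₗ[R] (ModuleCat.of R A × ModuleCat.of R B) :=
    (Submodule.prodEquivOfIsCompl A B hcompl).symm
  refine (hind.2 (ModuleCat.of R A) (ModuleCat.of R B)
    (e.toModuleIso ≪≫ (ModuleCat.biprodIsoProd _ _).symm)).imp
    (fun h => le_bot_iff.1 (hA₀.trans (key A h).le)) (fun h => le_bot_iff.1 (hB₀.trans (key B h).le))

end Uniform

/-! ### Injective hulls of uniform modules in `σ[M]` -/

section Hull

variable {R : Type u} [Ring R] {M : Type w} [AddCommGroup M] [Module R M]
  {E : Type w} [AddCommGroup E] [Module R E] {E' : Type w} [AddCommGroup E'] [Module R E']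
  {X : Type w} [AddCommGroup X] [Module R X] {Y : Type w} [AddCommGroup Y] [Module R Y]

/-- An `M`-generated module embeds in an `M`-generated `M`-injective module, namely in the trace
of `M` in an injective module containing it. -/
theorem IsGenerated.exists_isMInjective [Small.{w} R] (hX : IsGenerated (R := R) M X) :
    ∃ T : ModuleCat.{w} R, IsGenerated (R := R) M T ∧ IsMInjective R M T ∧
      ∃ k : X →ₗ[R] T, Function.Injective k := by
  let I : ModuleCat.{w} R := Injective.under (ModuleCat.of R X)
  let k : X →ₗ[R] I := (Injective.ι (ModuleCat.of R X)).hom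
  have hk : Function.Injective k := (ModuleCat.mono_iff_injective _).1 inferInstance
  have hI_inj : Injective I := inferInstanceAs (Injective (Injective.under (ModuleCat.of R X)))
  have hI : Module.Injective R I :=
    Module.injective_module_of_injective_object R I (inj := hI_inj)
  let F : ((M →ₗ[R] I) →₀ M) →ₗ[R] I := Finsupp.lsum ℕ fun f => f
  have hF (f : M →ₗ[R] I) (m : M) : f m ∈ LinearMap.range F :=
    ⟨Finsupp.single f m, by simp [F]⟩
  refine ⟨ModuleCat.of R (LinearMap.range F), ⟨_, F.rangeRestrict, F.surjective_rangeRestrict⟩,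
    fun K f => ?_, k.codRestrict (LinearMap.range F) ?_, fun x y h => hk (congrArg Subtype.val h)⟩
  · obtain ⟨g, hg⟩ := hI.out K.subtype K.subtype_injective ((LinearMap.range F).subtype ∘ₗ f)
    exact ⟨g.codRestrict _ (hF g), fun k => Subtype.ext (hg k)⟩
  · obtain ⟨ι, p, hp⟩ := hX
    intro x
    obtain ⟨c, rfl⟩ := hp x
    induction c using Finsupp.induction_linear with
    | zero => simp
    | add c d hc hd => simpa only [map_add] using add_mem hc hd
    | single i m => exact hF (k ∘ₗ p ∘ₗ Finsupp.lsingle i) m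

/-- A uniform submodule of an `M`-generated module embeds in an indecomposable `M`-injective
module of `σ[M]`: the latter is a maximal essential extension inside an `M`-injective module,
obtained as a complement of a complement. -/
theorem IsUniform.exists_indecInj [Small.{w} R] (hY : IsUniform R Y)
    (hX : IsGenerated (R := R) M X) (i : Y →ₗ[R] X) (hi : Function.Injective i) :
    ∃ (E : IndecInj R M) (j : Y →ₗ[R] E.1), Function.Injective j := by
  obtain ⟨T, hT, hTinj, k, hk⟩ := hX.exists_isMInjective
  let j : Y →ₗ[R] T := k ∘ₗ i
  have hj : Function.Injective j := hk.comp hi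
  obtain ⟨B, -, hB⟩ := exists_maximal_disjoint ⊥ (LinearMap.range j) disjoint_bot_left
  obtain ⟨A, hjA, hA⟩ := exists_maximal_disjoint (LinearMap.range j) B hB.prop.symm
  have hB' : Maximal (Disjoint · A) B :=
    ⟨hA.prop.symm, fun C hC hBC => hB.2 (hC.mono_right hjA) hBC⟩
  obtain ⟨r, hr, -⟩ := exists_projection_of_maximal_disjoint hTinj hT.inSigma hA hB'
  let j' : Y →ₗ[R] A := j.codRestrict A fun y => hjA ⟨y, rfl⟩
  have hj' : Function.Injective j' := fun x y h => hj (congrArg Subtype.val h)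
  have hA_unif : IsUniform R A := by
    refine hY.of_essential j' hj' fun Z hZ => ?_
    have hZA := Submodule.map_subtype_le A Z
    have hZ' : Disjoint (LinearMap.range j) (Z.map A.subtype) := by
      have := Submodule.disjoint_map A.subtype_injective hZ.symm
      rwa [← LinearMap.range_comp, LinearMap.subtype_comp_codRestrict] at this
    have hle : Z.map A.subtype ≤ B := by
      refine le_sup_right.trans (hB.2 (y := B ⊔ Z.map A.subtype) ?_ le_sup_left)
      change Disjoint (B ⊔ Z.map A.subtype) (LinearMap.range j)
      rw [sup_comm, disjoint_comm]
      exact hZ'.disjoint_sup_right_of_disjoint_sup_left (hA.prop.mono_left (sup_le hjA hZA))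
    rw [← map_eq_bot_iff_of_injective _ A.subtype_injective]
    exact disjoint_self.1 (hA.prop.mono hZA hle)
  exact ⟨⟨ModuleCat.of R A, hT.inSigma.of_injective A.subtype A.subtype_injective,
    hTinj.of_retract A.subtype r hr, hA_unif.indecomposable⟩, j', hj'⟩

/-- Two uniform `M`-injective modules of `σ[M]` with a common nonzero submodule are both its
injective hull in `σ[M]`. -/
theorem IsMInjective.nonempty_linearEquiv (hE : IsMInjective R M E) (hEσ : InSigma (R := R) M E)
    (hEu : IsUniform R E) (hE' : IsMInjective R M E') (hEσ' : InSigma (R := R) M E')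
    (hEu' : IsUniform R E') [Nontrivial Y] (i : Y →ₗ[R] E) (hi : Function.Injective i)
    (i' : Y →ₗ[R] E') (hi' : Function.Injective i') : Nonempty (E ≃ₗ[R] E') := by
  -- The extension `h` is injective since its kernel misses the nonzero image of `Y`; a retraction
  -- `r` of `h` is injective since its kernel misses the nonzero image of `h`.
  obtain ⟨h, hh⟩ := hE'.exists_extension hEσ i hi i'
  have hker : Disjoint (LinearMap.ker h) (LinearMap.range i) := by
    refine Submodule.disjoint_def.2 ?_
    rintro _ hx ⟨y, rfl⟩
    rw [LinearMap.mem_ker, hh] at hx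
    rw [hi' (hx.trans i'.map_zero.symm), map_zero]
  have hrange_i : LinearMap.range i ≠ ⊥ := fun h0 => by
    obtain ⟨y, hy⟩ := exists_ne (0 : Y)
    exact hy (hi (by simp [LinearMap.range_eq_bot.1 h0]))
  have hinj : Function.Injective h :=
    LinearMap.ker_eq_bot.1 ((hEu.2 _ _ hker).resolve_right hrange_i)
  obtain ⟨r, hr⟩ := hE.exists_extension hEσ' h hinj LinearMap.id
  simp only [LinearMap.id_apply] at hr
  have hdisj : Disjoint (LinearMap.ker r) (LinearMap.range h) := by
    refine Submodule.disjoint_def.2 ?_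
    rintro _ hx ⟨e, rfl⟩
    rw [LinearMap.mem_ker, hr] at hx
    rw [hx, map_zero]
  have := hEu.1
  have hrange_h : LinearMap.range h ≠ ⊥ := fun h0 => by
    obtain ⟨e, he⟩ := exists_ne (0 : E)
    exact he (hinj (by simp [LinearMap.range_eq_bot.1 h0]))
  have hrinj : Function.Injective r :=
    LinearMap.ker_eq_bot.1 ((hEu'.2 _ _ hdisj).resolve_right hrange_h)
  exact ⟨LinearEquiv.ofBijective h ⟨hinj, fun x => ⟨r x, hrinj (hr _)⟩⟩⟩

/-- A nonzero module embedded in a power `E ^ m` has a nonzero submodule embedded in `E`: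
otherwise the kernels of the `m` coordinate maps would be essential, and so would their
intersection, which is zero. -/
theorem exists_submodule_injective_of_pi [Nontrivial X] {m : ℕ} (g : X →ₗ[R] (Fin m → E))
    (hg : Function.Injective g) :
    ∃ Z : Submodule R X, Nontrivial Z ∧ ∃ f : Z →ₗ[R] E, Function.Injective f := by
  by_contra! hcon
  have hess (j : Fin m) (Z : Submodule R X) (hZ : Z ≠ ⊥) :
      Z ⊓ LinearMap.ker (LinearMap.proj j ∘ₗ g) ≠ ⊥ := fun h => by
    refine hcon Z (Submodule.nontrivial_iff_ne_bot.2 hZ) ((LinearMap.proj j ∘ₗ g).domRestrict Z)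
      (LinearMap.ker_eq_bot.1 ?_)
    rw [LinearMap.ker_domRestrict, ← Submodule.disjoint_iff_comap_eq_bot]
    exact disjoint_iff.2 h
  have hinf (s : Finset (Fin m)) : s.inf (fun j => LinearMap.ker (LinearMap.proj j ∘ₗ g)) ≠ ⊥ := by
    classical
    induction s using Finset.induction_on with
    | empty => exact top_ne_bot
    | insert j s _ ih =>
      rw [Finset.inf_insert, inf_comm]
      exact hess j _ ih
  refine hinf Finset.univ (eq_bot_iff.2 fun x hx => ?_)
  rw [Submodule.mem_bot]
  refine hg (funext fun j => ?_)
  have hle := Finset.inf_le (f := fun j => LinearMap.ker (LinearMap.proj j ∘ₗ g))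
    (Finset.mem_univ j)
  have hx := hle hx
  simpa using hx

end Hull

/-! ### The correspondence -/

section Correspondence

variable {R : Type u} [Ring R] {M : Type w} [AddCommGroup M] [Module R M]
  {X : Type w} [AddCommGroup X] [Module R X]

theorem IndecInj.isUniform (E : IndecInj R M) : IsUniform R E.1 :=
  E.2.2.1.isUniform E.2.1 E.2.2.2

theorem IsUniform.annModule_eq (hX : IsUniform R X) {Y Y' : Submodule R X}
    (hY : IsMPrimeModule R M Y) (hY' : IsMPrimeModule R M Y') :
    annModule (R := R) M Y = annModule M Y' := by
  have hne {Z : Submodule R X} (hZ : IsMPrimeModule R M Z) : Z ≠ ⊥ :=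
    Submodule.nontrivial_iff_ne_bot.1 (isMPrimeModule_iff.1 hZ).1
  have : Nontrivial (Y ⊓ Y' : Submodule R X) := Submodule.nontrivial_iff_ne_bot.2 fun h =>
    (hX.2 Y Y' (disjoint_iff.2 h)).elim (hne hY) (hne hY')
  have hle : Y ⊓ Y' ≤ Y := inf_le_left
  have hle' : Y ⊓ Y' ≤ Y' := inf_le_right
  rw [← hY.annModule_eq (Submodule.inclusion hle) (Submodule.inclusion_injective hle),
    ← hY'.annModule_eq (Submodule.inclusion hle') (Submodule.inclusion_injective hle')]

/-- Condition `H`, applied to the image of a nonzero map from `M` to a prime module `X` in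
`σ[M]`. -/
theorem ConditionH.exists_injective_pi (hH : ConditionH R M) (hX : IsMPrimeModule R M X)
    (hσ : InSigma (R := R) M X) {f : M →ₗ[R] X} (hf : f ≠ 0) :
    ∃ (m : ℕ) (g : (M ⧸ annModule (R := R) M X) →ₗ[R] (Fin m → X)), Function.Injective g := by
  have hinj := (LinearMap.range f).subtype_injective
  have : Nontrivial (LinearMap.range f) :=
    Submodule.nontrivial_iff_ne_bot.2 fun h => hf (LinearMap.range_eq_bot.1 h)
  obtain ⟨m, -, g, hg⟩ := hH (ModuleCat.of R (LinearMap.range f)) (hσ.of_injective _ hinj)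
    ⟨1, one_pos, f.rangeRestrict ∘ₗ LinearMap.proj 0,
      f.surjective_rangeRestrict.comp (LinearMap.proj_surjective 0)⟩
  have hann : annModule (R := R) M X = annModule M (LinearMap.range f) :=
    (hX.annModule_eq _ hinj).symm
  exact ⟨m, (LinearMap.range f).subtype.compLeft (Fin m) ∘ₗ g ∘ₗ
    (Submodule.quotEquivOfEq _ _ hann).toLinearMap,
    (hinj.comp_left).comp (hg.comp (LinearEquiv.injective _))⟩

/-- Let `Y ≤ E` and `Y' ≤ E'` be prime with the same annihilator `P`. By condition `H`, the module
`M / P` embeds in a power of `E` and in a power of `E'`, so `E` and `E'` share a nonzero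
submodule. -/
theorem IndecInj.nonempty_linearEquiv (hH : ConditionH R M)
    (hHom : ∀ X : ModuleCat.{w} R, InSigma (R := R) M X → Nontrivial X → ∃ f : M →ₗ[R] X, f ≠ 0)
    (E E' : IndecInj R M) {Y : Submodule R E.1} {Y' : Submodule R E'.1}
    (hY : IsMPrimeModule R M Y) (hY' : IsMPrimeModule R M Y')
    (h : annModule (R := R) M Y = annModule M Y') : Nonempty (E.1 ≃ₗ[R] E'.1) := by
  have hσ : InSigma (R := R) M Y := E.2.1.of_injective Y.subtype Y.subtype_injective
  have hσ' : InSigma (R := R) M Y' := E'.2.1.of_injective Y'.subtype Y'.subtype_injective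
  obtain ⟨f, hf⟩ := hHom (ModuleCat.of R Y) hσ (isMPrimeModule_iff.1 hY).1
  obtain ⟨f', hf'⟩ := hHom (ModuleCat.of R Y') hσ' (isMPrimeModule_iff.1 hY').1
  obtain ⟨m, g, hg⟩ := hH.exists_injective_pi hY hσ hf
  obtain ⟨m', g', hg'⟩ := hH.exists_injective_pi hY' hσ' hf'
  let q := Submodule.quotEquivOfEq _ _ h
  have : Nontrivial (M ⧸ annModule (R := R) M Y) :=
    Submodule.Quotient.nontrivial_iff.2 (annModule_ne_top_iff.2 ⟨f, hf⟩)
  obtain ⟨Z, _, i, hi⟩ := exists_submodule_injective_of_pi g hg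
  obtain ⟨Z', _, i', hi'⟩ := exists_submodule_injective_of_pi
    (g' ∘ₗ q.toLinearMap ∘ₗ Z.subtype) (hg'.comp (q.injective.comp Z.subtype_injective))
  have hj : Function.Injective (Y.subtype ∘ₗ i ∘ₗ Z'.subtype) :=
    Y.subtype_injective.comp (hi.comp Z'.subtype_injective)
  have hj' : Function.Injective (Y'.subtype ∘ₗ i') := Y'.subtype_injective.comp hi'
  exact IsMInjective.nonempty_linearEquiv (E := E.1) (E' := E'.1) (Y := Z') E.2.2.1 E.2.1
    E.isUniform E'.2.2.1 E'.2.1 E'.isUniform (Y.subtype ∘ₗ i ∘ₗ Z'.subtype) hj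
    (Y'.subtype ∘ₗ i') hj'

/-- Every prime `M`-ideal is the annihilator of a prime submodule of an indecomposable
`M`-injective module: the image in a prime module of a nonzero map from `M` is Noetherian, so it
has a uniform submodule, whose injective hull in `σ[M]` serves. -/
theorem IsPrimeMIdeal.exists_indecInj [Small.{w} R] [IsNoetherian R M] {P : Submodule R M}
    (hP : IsPrimeMIdeal P) : ∃ (E : IndecInj R M) (Y : Submodule R E.1),
      IsMPrimeModule R M Y ∧ annModule M Y = P := by
  obtain ⟨hne, -, X, hX, rfl⟩ := hP
  obtain ⟨f, hf⟩ := annModule_ne_top_iff.1 hne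
  have : Nontrivial (LinearMap.range f) :=
    Submodule.nontrivial_iff_ne_bot.2 fun h => hf (LinearMap.range_eq_bot.1 h)
  obtain ⟨V, hV⟩ := exists_submodule_isUniform (R := R) (X := LinearMap.range f)
  have hgen : IsGenerated (R := R) M (LinearMap.range f) :=
    ⟨PUnit, f.rangeRestrict ∘ₗ Finsupp.lapply PUnit.unit,
      f.surjective_rangeRestrict.comp fun m => ⟨Finsupp.single PUnit.unit m, by simp⟩⟩
  obtain ⟨E, j, hj⟩ := hV.exists_indecInj hgen V.subtype V.subtype_injective
  have := hV.1
  let e : V ≃ₗ[R] LinearMap.range j := LinearEquiv.ofInjective j hj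
  have := e.symm.toEquiv.nontrivial
  let i : LinearMap.range j →ₗ[R] X :=
    (LinearMap.range f).subtype ∘ₗ V.subtype ∘ₗ e.symm.toLinearMap
  have hi : Function.Injective i :=
    (LinearMap.range f).subtype_injective.comp (V.subtype_injective.comp e.symm.injective)
  exact ⟨E, LinearMap.range j, hX.of_injective i hi, hX.annModule_eq i hi⟩

end Correspondence

end MIdeal

theorem corollary4p2 {R : Type u} [Ring R] (M : Type (max u v)) [AddCommGroup M] [Module R M]
    [IsNoetherian R M] (hH : MIdeal.ConditionH R M)
    (hHom : ∀ X : ModuleCat.{max u v} R, MIdeal.InSigma (R := R) M X → Nontrivial X →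
      ∃ f : M →ₗ[R] X, f ≠ 0) :
    ∃ Φ : MIdeal.IndecInjClass R M ≃ {P : Submodule R M // MIdeal.IsPrimeMIdeal P},
      ∀ E : MIdeal.IndecInj R M,
        (∃ Y : Submodule R E.1, MIdeal.IsMPrimeModule R M Y) ∧
        ∀ Y : Submodule R E.1, MIdeal.IsMPrimeModule R M Y →
          MIdeal.annModule M Y = (Φ E.isoClass : Submodule R M) := by
  have hex (E : MIdeal.IndecInj R M) : ∃ Y : Submodule R E.1, MIdeal.IsMPrimeModule R M Y :=
    have := E.isUniform.1
    MIdeal.exists_submodule_isMPrimeModule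
  choose Y hY using hex
  have hprime (E : MIdeal.IndecInj R M) :
      MIdeal.IsPrimeMIdeal (MIdeal.annModule (R := R) M (Y E)) := by
    have hσ := E.2.1.of_injective (Y E).subtype (Y E).subtype_injective
    refine ⟨MIdeal.annModule_ne_top_iff.2 (hHom (ModuleCat.of R (Y E)) hσ
      (MIdeal.isMPrimeModule_iff.1 (hY E)).1), ⟨{ModuleCat.of R (Y E)}, ?_, rfl⟩,
      ModuleCat.of R (Y E), hY E, rfl⟩
    rintro _ rfl
    exact hσ
  let φ : MIdeal.IndecInjClass R M → {P : Submodule R M // MIdeal.IsPrimeMIdeal P} :=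
    Quotient.lift (fun E => ⟨_, hprime E⟩) (by
      rintro E E' ⟨e⟩
      have := (MIdeal.isMPrimeModule_iff.1 (hY E)).1
      let e' := Submodule.equivMapOfInjective e.toLinearMap e.injective (Y E)
      have := e'.symm.toEquiv.nontrivial
      have h := (hY E).of_injective e'.symm.toLinearMap e'.symm.injective
      exact Subtype.ext ((MIdeal.annModule_congr e').trans (E'.isUniform.annModule_eq h (hY E'))))
  have hφ : Function.Bijective φ := by
    constructor
    · intro a b
      induction a using Quotient.inductionOn with | h E => ?_
      induction b using Quotient.inductionOn with | h E' => ?_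
      intro h
      exact Quotient.sound
        (E.nonempty_linearEquiv hH hHom E' (hY E) (hY E') (congrArg Subtype.val h))
    · rintro ⟨P, hP⟩
      obtain ⟨E, Z, hZ, rfl⟩ := hP.exists_indecInj
      exact ⟨E.isoClass, Subtype.ext (E.isUniform.annModule_eq (hY E) hZ)⟩
  exact ⟨Equiv.ofBijective φ hφ, fun E =>
    ⟨⟨Y E, hY E⟩, fun Z hZ => E.isUniform.annModule_eq hZ (hY E)⟩⟩
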